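/- Let $n\in\mathbb N$, $T>0$ and $\Omega=(0,T)\times\mathbb R^n$. Let $H=H(t,p)$ be a real function of class $C^1$ on $[0,T]\times\mathbb R^n$ and let $\sigma:\mathbb R^n\to\mathbb R$ be convex and of class $C^1$, with Fenchel conjugate $\sigma^*(p)=\sup_{x\in\mathbb R^n}\{\langle x,p\rangle-\sigma(x)\}\in(-\infty,+\infty]$. Put $$\varphi(t,x,q)=\langle x,q\rangle-\sigma^*(q)-\int_0^tH(\tau,q)\,d\tau .$$ Assume: (A1) For every $(t_0,x_0)\in[0,T)\times\mathbb R^n$ there are $r,N>0$ such that $\varphi(t,x,p)<\max_{|q|\le N}\varphi(t,x,q)$ whenever $(t,x)\in[0,T)\times\mathbb R^n$, $|t-t_0|+|x-x_0|<r$ and $|p|>N$. (A2) At least one of the following holds: a) $H(t,\cdot)$ is convex for all $t\in(0,T)$, or $H(t,\cdot)$ is concave for all $t\in(0,T)$; b) there are functions $g,h,k$ with $H(t,p)=g(t)h(p)+k(t)$ for all $t\in(0,T)$, $p\in\mathbb R^n$, and either $g\ge0$ on $(0,T)$ or $g\le0$ on $(0,T)$. Let $u(t,x)=\max_{q\in\mathbb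 R^n}\varphi(t,x,q)$ for $(t,x)\in[0,T)\times\mathbb R^n$ (by (A1) the maximum is attained and finite). Call a point of $\Omega$ singular if $u$ is not differentiable, as a function of $(t,x)$, at that point. If $(t_0,x_0)\in\Omega$ is singular, then for every $\varepsilon>0$ there exists $\delta>0$ such that for every $t_*\in(t_0,t_0+\delta]$ there exists $x_*$ with $|x_*-x_0|\le\varepsilon$ such that $(t_*,x_*)$ is a singular point of $\Omega$ (in particular $t_0+\delta<T$). -/

import Mathlib

namespace HopfFormula

noncomputable section

/-- The Fenchel conjugate `σ*(p) = sup_x (⟨x, p⟩ - σ x)`, with values in the extended reals. -/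
def fenchelConj {n : ℕ} (σ : EuclideanSpace ℝ (Fin n) → ℝ) (p : EuclideanSpace ℝ (Fin n)) :
    EReal :=
  ⨆ x : EuclideanSpace ℝ (Fin n), ((inner ℝ x p - σ x : ℝ) : EReal)

/-- `φ(t, x, q) = ⟨x, q⟩ - σ*(q) - ∫₀ᵗ H(τ, q) dτ`; it equals `-∞` where `σ*(q) = +∞`. -/
def phi {n : ℕ} (H : ℝ → EuclideanSpace ℝ (Fin n) → ℝ) (σ : EuclideanSpace ℝ (Fin n) → ℝ)
    (t : ℝ) (x q : EuclideanSpace ℝ (Fin n)) : EReal :=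
  ((inner ℝ x q - ∫ τ in (0 : ℝ)..t, H τ q : ℝ) : EReal) - fenchelConj σ q

/-- The Hopf-type formula `u(t, x) = max_q φ(t, x, q)`. For continuous `H` and convex `σ`, the
compatibility condition below makes the supremum finite and attained for `0 ≤ t < T`, so that
`EReal.toReal` loses nothing there. -/
def hopf {n : ℕ} (H : ℝ → EuclideanSpace ℝ (Fin n) → ℝ) (σ : EuclideanSpace ℝ (Fin n) → ℝ)
    (t : ℝ) (x : EuclideanSpace ℝ (Fin n)) : ℝ :=
  (⨆ q : EuclideanSpace ℝ (Fin n), phi H σ t x q).toReal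

/-- The compatibility condition between `H` and `σ`: locally uniformly in `(t, x)`, the values
of `φ(t, x, ·)` outside some ball are strictly below its maximum over that ball. (The function
`φ(t, x, ·)` is upper semicontinuous, so the supremum over the closed ball is a maximum.) -/
def Compatible {n : ℕ} (T : ℝ) (H : ℝ → EuclideanSpace ℝ (Fin n) → ℝ)
    (σ : EuclideanSpace ℝ (Fin n) → ℝ) : Prop :=
  ∀ t₀ ∈ Set.Ico 0 T, ∀ x₀ : EuclideanSpace ℝ (Fin n),
    ∃ r > 0, ∃ N > 0, ∀ t ∈ Set.Ico 0 T, ∀ x p : EuclideanSpace ℝ (Fin n),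
      |t - t₀| + ‖x - x₀‖ < r → N < ‖p‖ →
        phi H σ t x p <
          ⨆ q ∈ Metric.closedBall (0 : EuclideanSpace ℝ (Fin n)) N, phi H σ t x q

/-- The structural condition on `H`: it is convex in `p` for all `t`, or concave in `p` for
all `t`, or of the form `g(t) h(p) + k(t)` with `g` of constant (weak) sign. -/
def Structural {n : ℕ} (T : ℝ) (H : ℝ → EuclideanSpace ℝ (Fin n) → ℝ) : Prop :=
  ((∀ t ∈ Set.Ioo 0 T, ConvexOn ℝ Set.univ (H t)) ∨
    (∀ t ∈ Set.Ioo 0 T, ConcaveOn ℝ Set.univ (H t))) ∨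
  ∃ (g : ℝ → ℝ) (h : EuclideanSpace ℝ (Fin n) → ℝ) (k : ℝ → ℝ),
    (∀ t ∈ Set.Ioo 0 T, ∀ p, H t p = g t * h p + k t) ∧
    ((∀ t ∈ Set.Ioo 0 T, 0 ≤ g t) ∨ (∀ t ∈ Set.Ioo 0 T, g t ≤ 0))

/-- `(t, x)` is a singular point of `u` in `Ω = (0, T) × ℝⁿ`: it lies in `Ω` and `u` is not
(jointly, Fréchet) differentiable there. -/
def IsSingular {n : ℕ} (T : ℝ) (u : ℝ → EuclideanSpace ℝ (Fin n) → ℝ)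
    (t : ℝ) (x : EuclideanSpace ℝ (Fin n)) : Prop :=
  t ∈ Set.Ioo 0 T ∧
    ¬ DifferentiableAt ℝ (fun z : ℝ × EuclideanSpace ℝ (Fin n) => u z.1 z.2) (t, x)

end

end HopfFormula

/-! Write `J_t(q) = ∫₀ᵗ H(τ, q) dτ`. The argument is by contraposition: if `u(t₁, ·)` is
differentiable on a small ball around `x₀` at a slightly later time `t₁`, then `φ(t₀, x₀, ·)` has a
unique maximizer, and this makes `u` differentiable at `(t₀, x₀)`
(`differentiableAt_hopf_of_unique`).

Since `φ` is affine in `x`, every maximizer at `(t₁, x)` is a subgradient of `u(t₁, ·)` at `x`,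
hence unique where `u(t₁, ·)` is differentiable. A variational argument
(`exists_eq_add_gradient_of_subgradient`) yields `p` such that `p` is the maximizer at `x = x₀ +
∇J_{t₁}(p) - ∇J_{t₀}(p)`: a characteristic that starts at `x₀`.

Strict maximality of `p` is carried back along this characteristic. If `J_{t₁} - J_{t₀}` is concave,
its tangent inequality at `p` suffices (`score_lt_of_concaveOn`). If the increments of `J_{t₀}` are
`c` times those of `J_{t₁}` with `0 ≤ c ≤ 1`, strict convexity of `σ*`, which comes from
differentiability of `σ`, is also needed (`score_lt_of_proportional`). If `J_{t₀}` is convex, the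
same strict convexity gives uniqueness at `(t₀, x₀)` directly (`eq_of_isMax_of_convexOn`). -/

open Metric Filter Topology

namespace HopfFormula

/-! ### First order conditions and subgradients. -/

section ConvexAnalysis

variable {E : Type*} [NormedAddCommGroup E] [InnerProductSpace ℝ E]

theorem nonneg_of_hasDerivAt_of_le {k : ℝ → ℝ} {k' : ℝ} (hk : HasDerivAt k k' 0)
    (h : ∀ r ∈ Set.Ioo (0 : ℝ) 1, k 0 ≤ k r) : 0 ≤ k' := by
  have h1 : Tendsto (slope k 0) (𝓝[>] 0) (𝓝 k') :=
    (hasDerivAt_iff_tendsto_slope.1 hk).mono_left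
      (nhdsWithin_mono _ fun x hx => ne_of_gt hx)
  refine ge_of_tendsto h1 ?_
  filter_upwards [Ioo_mem_nhdsGT (zero_lt_one : (0 : ℝ) < 1)] with r hr
  rw [slope_def_field]
  exact div_nonneg (sub_nonneg.2 (h r hr)) (by simpa using hr.1.le)

variable [CompleteSpace E]

theorem hasDerivAt_line_of_hasGradientAt {J : E → ℝ} {g p : E} (hJ : HasGradientAt J g p) (w : E) :
    HasDerivAt (fun r : ℝ => J (p + r • w)) (inner ℝ g w) 0 := by
  have h1 : HasDerivAt (fun r : ℝ => p + r • w) w 0 := by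
    simpa using ((hasDerivAt_id (0 : ℝ)).smul_const w).const_add p
  have h2 : HasFDerivAt J (InnerProductSpace.toDual ℝ E g) (p + (0 : ℝ) • w) := by
    simpa using hJ.hasFDerivAt
  have h3 := h2.comp_hasDerivAt (0 : ℝ) h1
  rwa [InnerProductSpace.toDual_apply_apply] at h3

/-- First order condition for a maximizer of `⟨x, ·⟩ - J - s` with `s` convex and `J` smooth. -/
theorem inner_sub_gradient_le {D : Set E} {s J : E → ℝ} (hs : ConvexOn ℝ D s) {x p g : E}
    (hp : p ∈ D) (hJ : HasGradientAt J g p)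
    (hmax : ∀ q ∈ D, inner ℝ x q - J q - s q ≤ inner ℝ x p - J p - s p) {q : E} (hq : q ∈ D) :
    inner ℝ (x - g) (q - p) ≤ s q - s p := by
  -- `s` need not be differentiable: along the segment from `p` to `q` it is bounded by its chord,
  -- and only this affine bound is differentiated.
  have hk := (hasDerivAt_line_of_hasGradientAt hJ (q - p)).sub
    ((hasDerivAt_id (0 : ℝ)).mul_const (inner ℝ x (q - p) - (s q - s p)))
  have h0 := nonneg_of_hasDerivAt_of_le hk ?_
  · rw [inner_sub_left]
    linarith
  · intro r hr
    have hc : (1 - r) • p + r • q = p + r • (q - p) := by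
      rw [smul_sub, sub_smul, one_smul]; abel
    have hmem : p + r • (q - p) ∈ D :=
      hc ▸ hs.1 hp hq (by linarith [hr.2]) hr.1.le (by ring)
    have h1 := hmax _ hmem
    have h2 := hs.2 hp hq (by linarith [hr.2] : 0 ≤ 1 - r) hr.1.le (by ring)
    rw [hc] at h2
    rw [inner_add_right, real_inner_smul_right] at h1
    simp only [smul_eq_mul] at h2
    simp only [Pi.sub_apply, zero_smul, add_zero, id, zero_mul, sub_zero]
    nlinarith

/-- A subgradient at an interior point of differentiability is the gradient. -/
theorem eq_of_forall_le_add_inner {v : E → ℝ} {x g p : E} (hv : HasGradientAt v g x)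
    (h : ∀ᶠ y in 𝓝 x, v x + inner ℝ p (y - x) ≤ v y) : p = g := by
  have hd : HasFDerivAt (fun y => v y - inner ℝ p (y - x))
      (InnerProductSpace.toDual ℝ E g - InnerProductSpace.toDual ℝ E p) x := by
    refine hv.hasFDerivAt.sub ?_
    simp only [inner_sub_right]
    exact (InnerProductSpace.toDual ℝ E p).hasFDerivAt.sub_const _
  have hmin : IsLocalMin (fun y => v y - inner ℝ p (y - x)) x := by
    filter_upwards [h] with y hy
    simp only [sub_self, inner_zero_right, sub_zero]
    linarith
  have h0 := hmin.hasFDerivAt_eq_zero hd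
  exact ((InnerProductSpace.toDual ℝ E).injective (sub_eq_zero.1 h0)).symm

end ConvexAnalysis

/-! ### The Fenchel conjugate, transport of maximizers, and existence of characteristics. -/

section Conjugate

variable {E : Type*} [NormedAddCommGroup E] [InnerProductSpace ℝ E]

/-- The effective domain of the Fenchel conjugate. -/
def conjDom (σ : E → ℝ) : Set E := {q | BddAbove (Set.range fun x => inner ℝ x q - σ x)}

/-- The Fenchel conjugate as a real function, meaningful on `conjDom σ`. -/
noncomputable def conjReal (σ : E → ℝ) (q : E) : ℝ := ⨆ x, (inner ℝ x q - σ x)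

theorem inner_sub_le_conjReal {σ : E → ℝ} {q : E} (hq : q ∈ conjDom σ) (x : E) :
    inner ℝ x q - σ x ≤ conjReal σ q := le_ciSup hq x

theorem convexOn_conjReal (σ : E → ℝ) : ConvexOn ℝ (conjDom σ) (conjReal σ) := by
  have key : ∀ p ∈ conjDom σ, ∀ q ∈ conjDom σ, ∀ a b : ℝ, 0 ≤ a → 0 ≤ b → a + b = 1 → ∀ x,
      inner ℝ x (a • p + b • q) - σ x ≤ a * conjReal σ p + b * conjReal σ q := by
    intro p hp q hq a b ha hb hab x
    rw [inner_add_right, real_inner_smul_right, real_inner_smul_right]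
    have h1 := mul_le_mul_of_nonneg_left (inner_sub_le_conjReal hp x) ha
    have h2 := mul_le_mul_of_nonneg_left (inner_sub_le_conjReal hq x) hb
    have h3 : σ x = a * σ x + b * σ x := by rw [← add_mul, hab, one_mul]
    linarith
  refine ⟨fun p hp q hq a b ha hb hab =>
    ⟨a * conjReal σ p + b * conjReal σ q, ?_⟩, fun p hp q hq a b ha hb hab =>
    ciSup_le (key p hp q hq a b ha hb hab)⟩
  rintro _ ⟨x, rfl⟩
  exact key p hp q hq a b ha hb hab x

/-- `⟨x, q⟩ - J q - σ* q`, meaningful for `q` in `conjDom σ`. -/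
noncomputable def score (σ J : E → ℝ) (x q : E) : ℝ := inner ℝ x q - J q - conjReal σ q

theorem score_def (σ J : E → ℝ) (x q : E) :
    score σ J x q = inner ℝ x q - J q - conjReal σ q := rfl

variable [CompleteSpace E]

theorem inner_sub_le_of_hasGradientAt {σ : E → ℝ} (hσc : ConvexOn ℝ Set.univ σ) {y m : E}
    (hm : HasGradientAt σ m y) (x : E) : inner ℝ x m - σ x ≤ inner ℝ y m - σ y := by
  have h := nonneg_of_hasDerivAt_of_le
    (((hasDerivAt_id (0 : ℝ)).mul_const (σ x - σ y)).sub (hasDerivAt_line_of_hasGradientAt hm (x - y))) ?_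
  · rw [inner_sub_right, real_inner_comm x m, real_inner_comm y m] at h
    linarith
  · intro r hr
    have h2 := hσc.2 (Set.mem_univ y) (Set.mem_univ x) (by linarith [hr.2] : 0 ≤ 1 - r) hr.1.le
      (by ring)
    have hc : (1 - r) • y + r • x = y + r • (x - y) := by
      rw [smul_sub, sub_smul, one_smul]; abel
    rw [hc] at h2
    simp only [smul_eq_mul] at h2
    simp only [Pi.sub_apply, zero_smul, add_zero, id, zero_mul]
    linarith

theorem mem_conjDom_of_hasGradientAt {σ : E → ℝ} (hσc : ConvexOn ℝ Set.univ σ) {y m : E}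
    (hm : HasGradientAt σ m y) : m ∈ conjDom σ := by
  refine ⟨inner ℝ y m - σ y, ?_⟩
  rintro _ ⟨x, rfl⟩
  exact inner_sub_le_of_hasGradientAt hσc hm x

theorem conjReal_le_of_hasGradientAt {σ : E → ℝ} (hσc : ConvexOn ℝ Set.univ σ) {y m : E}
    (hm : HasGradientAt σ m y) : conjReal σ m ≤ inner ℝ y m - σ y :=
  ciSup_le (inner_sub_le_of_hasGradientAt hσc hm)

/-- Equality in Fenchel's inequality makes `p` a subgradient of `σ` at `y`, and differentiability
leaves only one. -/
theorem eq_gradient_of_conjReal_le {σ : E → ℝ} {y m p : E} (hm : HasGradientAt σ m y)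
    (hp : p ∈ conjDom σ) (h : conjReal σ p ≤ inner ℝ y p - σ y) : p = m := by
  refine eq_of_forall_le_add_inner hm (Eventually.of_forall fun z => ?_)
  have := inner_sub_le_conjReal hp z
  rw [inner_sub_right, real_inner_comm z p, real_inner_comm y p]
  linarith

/-- The conjugate of a smooth convex function is strictly convex in the sense that a subgradient
inequality is strict away from the base point. -/
theorem inner_lt_conjReal_sub {σ : E → ℝ} (hσ : Differentiable ℝ σ)
    (hσc : ConvexOn ℝ Set.univ σ) {y p : E} (hp : p ∈ conjDom σ)
    (h : ∀ q ∈ conjDom σ, inner ℝ y (q - p) ≤ conjReal σ q - conjReal σ p) {q : E}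
    (hq : q ∈ conjDom σ) (hne : q ≠ p) : inner ℝ y (q - p) < conjReal σ q - conjReal σ p := by
  have hm := (hσ y).hasGradientAt
  -- Testing the subgradient inequality at `∇σ(y)` gives equality in Fenchel's inequality at `p`, so
  -- `p = ∇σ(y)`. A second point of equality would also be `∇σ(y)`.
  have h1 := h _ (mem_conjDom_of_hasGradientAt hσc hm)
  have h2 := conjReal_le_of_hasGradientAt hσc hm
  rw [inner_sub_right] at h1
  have hpm := eq_gradient_of_conjReal_le hm hp (by linarith)
  refine lt_of_le_of_ne (h q hq) fun heq => hne ?_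
  rw [inner_sub_right] at heq
  rw [hpm]
  exact eq_gradient_of_conjReal_le hm hq (by linarith)

/-- The midpoint `m` of two maximizers is a maximizer, so `x - ∇J(m)` is a subgradient of `σ*` at
`m`. Its inequality is strict at `p`; adding the one at `q` contradicts the midpoint value of `σ*`.
-/
theorem eq_of_isMax_of_convexOn {σ J : E → ℝ} (hσ : Differentiable ℝ σ)
    (hσc : ConvexOn ℝ Set.univ σ) (hJ : Differentiable ℝ J) (hJc : ConvexOn ℝ Set.univ J)
    {x p q : E} (hp : p ∈ conjDom σ) (hq : q ∈ conjDom σ)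
    (hpm : ∀ r ∈ conjDom σ, score σ J x r ≤ score σ J x p)
    (hqm : ∀ r ∈ conjDom σ, score σ J x r ≤ score σ J x q) : q = p := by
  by_contra hne
  set m : E := (1 / 2 : ℝ) • p + (1 / 2 : ℝ) • q with hm
  have hmD : m ∈ conjDom σ :=
    (convexOn_conjReal σ).1 hp hq (by norm_num) (by norm_num) (by norm_num)
  have e1 := (convexOn_conjReal σ).2 hp hq (by norm_num : (0 : ℝ) ≤ 1 / 2)
    (by norm_num : (0 : ℝ) ≤ 1 / 2) (by norm_num)
  have e2 := hJc.2 (Set.mem_univ p) (Set.mem_univ q) (by norm_num : (0 : ℝ) ≤ 1 / 2)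
    (by norm_num : (0 : ℝ) ≤ 1 / 2) (by norm_num)
  rw [← hm] at e1 e2
  simp only [smul_eq_mul] at e1 e2
  have e3 : inner ℝ x m = 1 / 2 * inner ℝ x p + 1 / 2 * inner ℝ x q := by
    rw [hm, inner_add_right, real_inner_smul_right, real_inner_smul_right]
  have e4 := hpm m hmD
  have e5 := hpm q hq
  have e6 := hqm p hp
  simp only [score_def] at e4 e5 e6
  have hmm : ∀ r ∈ conjDom σ, score σ J x r ≤ score σ J x m := by
    intro r hr
    have := hpm r hr
    simp only [score_def] at this ⊢
    linarith
  have hsub := fun r (hr : r ∈ conjDom σ) =>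
    inner_sub_gradient_le (convexOn_conjReal σ) hmD (hJ m).hasGradientAt hmm hr
  have hpm' : p ≠ m := by
    intro h
    apply hne
    have h2 : (1 / 2 : ℝ) • q = (1 / 2 : ℝ) • p := by
      have : (1 / 2 : ℝ) • p + (1 / 2 : ℝ) • p = (1 / 2 : ℝ) • p + (1 / 2 : ℝ) • q := by
        rw [← hm, ← h, ← add_smul]; norm_num
      exact (add_left_cancel this).symm
    exact smul_right_injective E (by norm_num : (1 / 2 : ℝ) ≠ 0) h2
  have f1 := inner_lt_conjReal_sub hσ hσc hmD hsub hp hpm'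
  have f2 := hsub q hq
  have f3 : inner ℝ (x - gradient J m) (p - m) + inner ℝ (x - gradient J m) (q - m) = 0 := by
    rw [← inner_add_right]
    have : p - m + (q - m) = 0 := by
      rw [hm]; module
    rw [this, inner_zero_right]
  linarith

/-- Transport of a unique maximizer along a characteristic when the increment is concave. -/
theorem score_lt_of_concaveOn {σ J₀ J₁ : E → ℝ} {g₀ g₁ x p : E}
    (h₀ : HasGradientAt J₀ g₀ p) (h₁ : HasGradientAt J₁ g₁ p)
    (hc : ConcaveOn ℝ Set.univ fun q => J₁ q - J₀ q) {q : E}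
    (hlt : score σ J₁ (x + (g₁ - g₀)) q < score σ J₁ (x + (g₁ - g₀)) p) :
    score σ J₀ x q < score σ J₀ x p := by
  have hg : HasGradientAt (fun q => -(J₁ q - J₀ q)) (-(g₁ - g₀)) p := by
    rw [hasGradientAt_iff_hasFDerivAt, map_neg, map_sub]
    exact (h₁.hasFDerivAt.sub h₀.hasFDerivAt).neg
  -- The two scores differ by `J₁ - J₀` minus its linear part at `p`, a concave function with
  -- maximum at `p`.
  have h := inner_sub_le_of_hasGradientAt hc.neg hg q
  simp only [score_def, inner_add_left, inner_neg_right, Pi.neg_apply] at *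
  rw [real_inner_comm (g₁ - g₀) q, real_inner_comm (g₁ - g₀) p] at h
  linarith

/-- Transport of a unique maximizer along a characteristic when the two integrals are
proportional up to a constant. -/
theorem score_lt_of_proportional {σ J₀ J₁ : E → ℝ} (hσ : Differentiable ℝ σ)
    (hσc : ConvexOn ℝ Set.univ σ) {g₀ g₁ x p : E}
    (h₀ : HasGradientAt J₀ g₀ p) (h₁ : HasGradientAt J₁ g₁ p) {c : ℝ} (hc₀ : 0 ≤ c) (hc₁ : c ≤ 1)
    (hc : ∀ q, J₀ q - J₀ p = c * (J₁ q - J₁ p)) (hp : p ∈ conjDom σ)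
    (hmax : ∀ q ∈ conjDom σ, q ≠ p →
      score σ J₁ (x + (g₁ - g₀)) q < score σ J₁ (x + (g₁ - g₀)) p)
    {q : E} (hq : q ∈ conjDom σ) (hne : q ≠ p) :
    score σ J₀ x q < score σ J₀ x p := by
  have hg : g₀ = c • g₁ := by
    refine h₀.unique ?_
    have : J₀ = fun q => c * (J₁ q - J₁ p) + J₀ p := by
      funext q; linarith [hc q]
    rw [this, hasGradientAt_iff_hasFDerivAt, map_smul]
    exact ((h₁.hasFDerivAt.sub_const _).const_mul c).add_const _
  have hmax' : ∀ q ∈ conjDom σ,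
      score σ J₁ (x + (g₁ - g₀)) q ≤ score σ J₁ (x + (g₁ - g₀)) p := fun q hq => by
    by_cases h : q = p
    · rw [h]
    · exact (hmax q hq h).le
  have hsub := fun r (hr : r ∈ conjDom σ) =>
    inner_sub_gradient_le (convexOn_conjReal σ) hp h₁ hmax' hr
  -- By `hsub`, `x - g₀` is a subgradient of `σ*` at `p`. The score gap for `J₀` is `c` times the
  -- gap for `J₁` plus `1 - c` times the gap in this subgradient inequality.
  have f1 := inner_lt_conjReal_sub hσ hσc hp hsub hq hne
  have f2 := hmax q hq hne
  have f3 := hc q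
  simp only [score_def, inner_add_left, inner_sub_left, inner_sub_right, hg,
    real_inner_smul_left] at *
  rcases eq_or_lt_of_le hc₁ with rfl | hlt
  · linarith
  · nlinarith [mul_pos (sub_pos.2 hlt) (sub_pos.2 f1), mul_nonneg hc₀ (sub_pos.2 f2).le]

/-- If `v` has subgradients bounded by `N` on a ball and `F` is a smooth function with small
gradient, then some `x` in the ball has a subgradient `p` with `x = x₀ + ∇F(p)`. The point `p` is
found by maximizing `⟨x₀, ·⟩ + F` minus the conjugate of the restriction of `v` to the ball. -/
theorem exists_eq_add_gradient_of_subgradient [FiniteDimensional ℝ E] {v F : E → ℝ} {F' : E → E}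
    {x₀ : E} {ε N : ℝ} (hN : 0 ≤ N) (hε : 0 < ε) (hv : ContinuousOn v (closedBall x₀ ε))
    (hF : ∀ q, HasGradientAt F (F' q) q) (hF' : ∀ q, ‖q‖ ≤ N → ‖F' q‖ < ε)
    (hsub : ∀ x ∈ closedBall x₀ ε, ∃ m, ‖m‖ ≤ N ∧
      ∀ y ∈ closedBall x₀ ε, v x + inner ℝ m (y - x) ≤ v y) :
    ∃ p, ‖p‖ ≤ N ∧ ∀ y ∈ closedBall x₀ ε,
      v (x₀ + F' p) + inner ℝ p (y - (x₀ + F' p)) ≤ v y := by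
  have : ProperSpace E := FiniteDimensional.proper ℝ E
  have : Nonempty (closedBall x₀ ε) := ⟨⟨x₀, mem_closedBall_self hε.le⟩⟩
  set V : E → ℝ := fun q => ⨆ y : closedBall x₀ ε, (inner ℝ (y : E) q - v y) with hV
  have hbdd : ∀ q, BddAbove (Set.range fun y : closedBall x₀ ε => inner ℝ (y : E) q - v y) := by
    intro q
    have := (isCompact_closedBall x₀ ε).bddAbove_image (f := fun y => inner ℝ y q - v y)
      ((Continuous.continuousOn (by fun_prop)).sub hv)
    rwa [Set.image_eq_range] at this
  have hle : ∀ q, ∀ y ∈ closedBall x₀ ε, inner ℝ y q - v y ≤ V q := fun q y hy =>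
    le_ciSup (hbdd q) ⟨y, hy⟩
  have hVlsc : LowerSemicontinuous V :=
    lowerSemicontinuous_ciSup hbdd fun y =>
      Continuous.lowerSemicontinuous (by fun_prop)
  have hVc : ConvexOn ℝ (closedBall (0 : E) N) V := by
    refine ⟨convex_closedBall _ _, fun p _ q _ a b ha hb hab => ciSup_le fun y => ?_⟩
    rw [inner_add_right, real_inner_smul_right, real_inner_smul_right]
    have h1 := mul_le_mul_of_nonneg_left (hle p y y.2) ha
    have h2 := mul_le_mul_of_nonneg_left (hle q y y.2) hb
    have h3 : v y = a * v y + b * v y := by rw [← add_mul, hab, one_mul]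
    simp only [smul_eq_mul]
    linarith
  have hFc : Continuous F := continuous_iff_continuousAt.2 fun q => (hF q).continuousAt
  have husc : UpperSemicontinuous fun q => (inner ℝ x₀ q + F q) + -V q :=
    (Continuous.upperSemicontinuous (by fun_prop)).add
      (continuous_neg.comp_lowerSemicontinuous_antitone hVlsc fun _ _ h => neg_le_neg h)
  obtain ⟨p, hp, hpmax⟩ := UpperSemicontinuousOn.exists_isMaxOn
    ⟨0, mem_closedBall_self hN⟩ (isCompact_closedBall (0 : E) N) (husc.upperSemicontinuousOn _)
  have hpN : ‖p‖ ≤ N := by simpa using hp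
  have hneg : HasGradientAt (fun q => -F q) (-F' p) p := by
    rw [hasGradientAt_iff_hasFDerivAt, map_neg]
    exact (hF p).hasFDerivAt.neg
  have hfirst := fun q (hq : q ∈ closedBall (0 : E) N) =>
    inner_sub_gradient_le (x := x₀) hVc hp hneg
    (fun q hq => by have := hpmax hq; simp only [Set.mem_ofPred_eq] at this; linarith) hq
  rw [sub_neg_eq_add] at hfirst
  set x := x₀ + F' p with hx
  have hxB : x ∈ closedBall x₀ ε := by
    rw [mem_closedBall, dist_eq_norm, hx, add_sub_cancel_left]
    -- The first order condition now reads `⟨x, q - p⟩ ≤ V q - V p` for `‖q‖ ≤ N`. With `q = m`, a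
    -- subgradient of `v` at `x`, it gives `V p ≤ ⟨x, p⟩ - v x`, so `p` is a subgradient at `x` as
    -- well.
    exact (hF' p hpN).le
  obtain ⟨m, hmN, hm⟩ := hsub x hxB
  have h1 : V m ≤ inner ℝ x m - v x := by
    refine ciSup_le fun y => ?_
    have := hm y y.2
    rw [inner_sub_right, real_inner_comm (y : E) m, real_inner_comm x m] at this
    linarith
  have h2 := hfirst m (by simpa using hmN)
  refine ⟨p, hpN, fun y hy => ?_⟩
  have h3 := hle p y hy
  rw [inner_sub_right] at h2 ⊢
  rw [real_inner_comm y p, real_inner_comm x p]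
  linarith

end Conjugate

/-! ### Maximizers of `φ` and differentiability of the Hopf formula. -/

section Maximizers

variable {n : ℕ} {H : ℝ → EuclideanSpace ℝ (Fin n) → ℝ} {σ : EuclideanSpace ℝ (Fin n) → ℝ}

/-- The primitive `∫₀ᵗ H(τ, q) dτ`. -/
noncomputable def primitive (H : ℝ → EuclideanSpace ℝ (Fin n) → ℝ) (t : ℝ)
    (q : EuclideanSpace ℝ (Fin n)) : ℝ := ∫ τ in (0 : ℝ)..t, H τ q

theorem fenchelConj_of_mem {q : EuclideanSpace ℝ (Fin n)} (hq : q ∈ conjDom σ) :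
    fenchelConj σ q = (conjReal σ q : EReal) := by
  refine le_antisymm (iSup_le fun x => ?_) ?_
  · exact EReal.coe_le_coe_iff.2 (inner_sub_le_conjReal hq x)
  · refine EReal.le_of_forall_lt_iff_le.1 fun c hc => ?_
    have h : conjReal σ q ≤ c := ciSup_le fun x =>
      EReal.coe_le_coe_iff.1 ((le_iSup
        (fun x : EuclideanSpace ℝ (Fin n) => ((inner ℝ x q - σ x : ℝ) : EReal)) x).trans hc.le)
    exact EReal.coe_le_coe_iff.2 h

theorem fenchelConj_of_notMem {q : EuclideanSpace ℝ (Fin n)} (hq : q ∉ conjDom σ) :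
    fenchelConj σ q = ⊤ := by
  refine EReal.eq_top_iff_forall_lt _ |>.2 fun c => ?_
  by_contra! hc
  refine hq ⟨c, ?_⟩
  rintro _ ⟨x, rfl⟩
  exact EReal.coe_le_coe_iff.1 ((le_iSup
    (fun x : EuclideanSpace ℝ (Fin n) => ((inner ℝ x q - σ x : ℝ) : EReal)) x).trans hc)

theorem phi_of_mem {q : EuclideanSpace ℝ (Fin n)} (hq : q ∈ conjDom σ) (t : ℝ)
    (x : EuclideanSpace ℝ (Fin n)) :
    phi H σ t x q = (score σ (primitive H t) x q : EReal) := by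
  rw [phi, fenchelConj_of_mem hq, ← EReal.coe_sub]
  rfl

theorem phi_of_notMem {q : EuclideanSpace ℝ (Fin n)} (hq : q ∉ conjDom σ) (t : ℝ)
    (x : EuclideanSpace ℝ (Fin n)) : phi H σ t x q = ⊥ := by
  rw [phi, fenchelConj_of_notMem hq, EReal.sub_top]

/-- An infimum of functions continuous in `(t, x, q)`, which yields joint upper semicontinuity even
where `σ*` is infinite. -/
theorem phi_eq_iInf (t : ℝ) (x q : EuclideanSpace ℝ (Fin n)) :
    phi H σ t x q = ⨅ y : EuclideanSpace ℝ (Fin n),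
      ((inner ℝ x q - primitive H t q - (inner ℝ y q - σ y) : ℝ) : EReal) := by
  refine le_antisymm (le_iInf fun y => ?_) ?_
  · rw [phi, EReal.coe_sub (inner ℝ x q - primitive H t q)]
    exact EReal.sub_le_sub le_rfl (le_iSup
      (fun y : EuclideanSpace ℝ (Fin n) => ((inner ℝ y q - σ y : ℝ) : EReal)) y)
  · by_cases hq : q ∈ conjDom σ
    · rw [phi_of_mem hq]
      refine EReal.le_of_forall_lt_iff_le.1 fun c hc => ?_
      have hc' := EReal.coe_lt_coe_iff.1 hc
      have : inner ℝ x q - primitive H t q - c < conjReal σ q := by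
        rw [score_def] at hc'; linarith
      obtain ⟨y, hy⟩ := exists_lt_of_lt_ciSup this
      exact (iInf_le _ y).trans (EReal.coe_le_coe_iff.2 (by linarith))
    · rw [phi_of_notMem hq, le_bot_iff, EReal.eq_bot_iff_forall_lt]
      intro c
      have : ∃ y, inner ℝ x q - primitive H t q - c < inner ℝ y q - σ y := by
        by_contra! h
        refine hq ⟨inner ℝ x q - primitive H t q - c, ?_⟩
        rintro _ ⟨y, rfl⟩
        exact h y
      obtain ⟨y, hy⟩ := this
      exact (iInf_le _ y).trans_lt (EReal.coe_lt_coe_iff.2 (by linarith))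

theorem continuous_primitive (hH : Continuous (Function.uncurry H)) :
    Continuous fun z : ℝ × EuclideanSpace ℝ (Fin n) => primitive H z.1 z.2 := by
  refine intervalIntegral.continuous_parametric_intervalIntegral_of_continuous
    (f := fun (z : ℝ × EuclideanSpace ℝ (Fin n)) τ => H τ z.2) ?_ continuous_fst
  exact hH.comp (by fun_prop : Continuous
    fun w : (ℝ × EuclideanSpace ℝ (Fin n)) × ℝ => (w.2, w.1.2))

theorem upperSemicontinuous_phi (hH : Continuous (Function.uncurry H)) :
    UpperSemicontinuous fun z : (ℝ × EuclideanSpace ℝ (Fin n)) × EuclideanSpace ℝ (Fin n) =>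
      phi H σ z.1.1 z.1.2 z.2 := by
  simp only [phi_eq_iInf]
  refine upperSemicontinuous_iInf fun y => Continuous.upperSemicontinuous ?_
  have := (continuous_primitive hH).comp (by fun_prop : Continuous fun
    z : (ℝ × EuclideanSpace ℝ (Fin n)) × EuclideanSpace ℝ (Fin n) => (z.1.1, z.2))
  simp only [Function.comp_def] at this
  exact continuous_coe_real_ereal.comp (by fun_prop)

theorem continuous_score (hH : Continuous (Function.uncurry H)) (q : EuclideanSpace ℝ (Fin n)) :
    Continuous fun z : ℝ × EuclideanSpace ℝ (Fin n) => score σ (primitive H z.1) z.2 q := by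
  have := (continuous_primitive hH).comp (by fun_prop : Continuous fun
    z : ℝ × EuclideanSpace ℝ (Fin n) => (z.1, q))
  simp only [Function.comp_def] at this
  simp only [score_def]
  fun_prop

/-- `p` maximizes `φ(t, x, ·)`. -/
def IsMaximizer (H : ℝ → EuclideanSpace ℝ (Fin n) → ℝ) (σ : EuclideanSpace ℝ (Fin n) → ℝ)
    (t : ℝ) (x p : EuclideanSpace ℝ (Fin n)) : Prop :=
  p ∈ conjDom σ ∧ ∀ q ∈ conjDom σ, score σ (primitive H t) x q ≤ score σ (primitive H t) x p

theorem IsMaximizer.phi_le {t : ℝ} {x p : EuclideanSpace ℝ (Fin n)} (hp : IsMaximizer H σ t x p)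
    (q : EuclideanSpace ℝ (Fin n)) : phi H σ t x q ≤ phi H σ t x p := by
  by_cases hq : q ∈ conjDom σ
  · rw [phi_of_mem hq, phi_of_mem hp.1]
    exact EReal.coe_le_coe_iff.2 (hp.2 q hq)
  · rw [phi_of_notMem hq]
    exact bot_le

theorem IsMaximizer.hopf_eq {t : ℝ} {x p : EuclideanSpace ℝ (Fin n)}
    (hp : IsMaximizer H σ t x p) : hopf H σ t x = score σ (primitive H t) x p := by
  have : ⨆ q, phi H σ t x q = phi H σ t x p :=
    le_antisymm (iSup_le hp.phi_le) (le_iSup (phi H σ t x) p)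
  rw [hopf, this, phi_of_mem hp.1, EReal.toReal_coe]

theorem IsMaximizer.norm_le {t N : ℝ} {x p : EuclideanSpace ℝ (Fin n)}
    (hp : IsMaximizer H σ t x p)
    (hA : ∀ p, N < ‖p‖ → phi H σ t x p <
      ⨆ q ∈ closedBall (0 : EuclideanSpace ℝ (Fin n)) N, phi H σ t x q) : ‖p‖ ≤ N := by
  by_contra! h
  exact absurd (hA p h) (not_lt.2 (iSup₂_le fun q _ => hp.phi_le q))

theorem exists_isMaximizer (hH : Continuous (Function.uncurry H)) (hne : (conjDom σ).Nonempty)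
    {t N : ℝ} (hN : 0 ≤ N) {x : EuclideanSpace ℝ (Fin n)}
    (hA : ∀ p, N < ‖p‖ → phi H σ t x p <
      ⨆ q ∈ closedBall (0 : EuclideanSpace ℝ (Fin n)) N, phi H σ t x q) :
    ∃ p, IsMaximizer H σ t x p := by
  have husc : UpperSemicontinuous fun q => phi H σ t x q :=
    (upperSemicontinuous_phi hH).comp (g := fun q => ((t, x), q)) (by fun_prop)
  obtain ⟨p, -, hmax⟩ := UpperSemicontinuousOn.exists_isMaxOn
    ⟨0, mem_closedBall_self hN⟩ (isCompact_closedBall (0 : EuclideanSpace ℝ (Fin n)) N)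
    (husc.upperSemicontinuousOn _)
  have hle : ∀ q, phi H σ t x q ≤ phi H σ t x p := by
    intro q
    rcases le_or_gt ‖q‖ N with h | h
    · exact hmax (by simpa using h)
    · exact (hA q h).le.trans (iSup₂_le fun q hq => hmax hq)
  have hp : p ∈ conjDom σ := by
    by_contra hp
    obtain ⟨q, hq⟩ := hne
    have := hle q
    rw [phi_of_notMem hp, phi_of_mem hq, le_bot_iff] at this
    exact EReal.coe_ne_bot _ this
  refine ⟨p, hp, fun q hq => ?_⟩
  have := hle q
  rwa [phi_of_mem hp, phi_of_mem hq, EReal.coe_le_coe_iff] at this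

/-- Upper semicontinuity of the set of maximizers at a point where the maximizer is unique. -/
theorem eventually_isMaximizer_near (hH : Continuous (Function.uncurry H))
    {t₀ N η : ℝ} {x₀ p : EuclideanSpace ℝ (Fin n)} (hη : 0 < η) (hp : p ∈ conjDom σ)
    (huniq : ∀ q ∈ conjDom σ, q ≠ p →
      score σ (primitive H t₀) x₀ q < score σ (primitive H t₀) x₀ p) :
    ∀ᶠ z : ℝ × EuclideanSpace ℝ (Fin n) in 𝓝 (t₀, x₀), ∀ q, ‖q‖ ≤ N →
      IsMaximizer H σ z.1 z.2 q → ‖q - p‖ < η := by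
  have hK : IsCompact (closedBall (0 : EuclideanSpace ℝ (Fin n)) N \ ball p η) :=
    (isCompact_closedBall _ _).diff isOpen_ball
  have := hK.eventually_forall_of_forall_eventually (x₀ := (t₀, x₀))
    (P := fun z q => phi H σ z.1 z.2 q < (score σ (primitive H z.1) z.2 p : EReal)) ?_
  · filter_upwards [this] with z hz q hqN hq
    by_contra! hge
    have h1 := hz q ⟨by simpa using hqN, by simpa [dist_eq_norm] using hge⟩
    have h2 := hq.phi_le p
    rw [phi_of_mem hp] at h2
    exact absurd h1 (not_lt.2 h2)
  · intro q hq
    have hqp : q ≠ p := fun h => hq.2 (h ▸ mem_ball_self hη)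
    have hlt : phi H σ t₀ x₀ q < (score σ (primitive H t₀) x₀ p : EReal) := by
      by_cases hqD : q ∈ conjDom σ
      · rw [phi_of_mem hqD]
        exact EReal.coe_lt_coe_iff.2 (huniq q hqD hqp)
      · rw [phi_of_notMem hqD]
        exact EReal.bot_lt_coe _
    obtain ⟨c, hc1, hc2⟩ := EReal.lt_iff_exists_real_btwn.1 hlt
    have e1 := upperSemicontinuous_phi (σ := σ) hH ((t₀, x₀), q) c hc1
    have e2 : ∀ᶠ z : (ℝ × EuclideanSpace ℝ (Fin n)) × EuclideanSpace ℝ (Fin n) in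
        𝓝 ((t₀, x₀), q), c < score σ (primitive H z.1.1) z.1.2 p :=
      ((continuous_score hH p).comp continuous_fst).continuousAt.eventually
        (lt_mem_nhds (EReal.coe_lt_coe_iff.1 hc2))
    filter_upwards [e1, e2] with z h1 h2
    exact h1.trans (EReal.coe_lt_coe_iff.2 h2)

/-- The term `σ* q` cancels in the increment, so a first order expansion uniform in `q` near `p`
needs no regularity of `σ*`. -/
theorem abs_score_sub_score_sub_le (hH : Continuous (Function.uncurry H)) {t t₀ c : ℝ}
    {x x₀ p q : EuclideanSpace ℝ (Fin n)} (hc : ‖q - p‖ ≤ c / 2)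
    (hHc : ∀ τ, |τ - t₀| ≤ |t - t₀| → |H τ q - H t₀ p| ≤ c / 2) :
    |score σ (primitive H t) x q - score σ (primitive H t₀) x₀ q -
      (inner ℝ p (x - x₀) - (t - t₀) * H t₀ p)| ≤ c * ‖(t, x) - (t₀, x₀)‖ := by
  have hint : ∀ a b, IntervalIntegrable (fun τ => H τ q) MeasureTheory.volume a b := fun a b =>
    (hH.comp (by fun_prop : Continuous fun τ : ℝ => (τ, q))).intervalIntegrable a b
  have h1 : primitive H t q - primitive H t₀ q - (t - t₀) * H t₀ p =
      ∫ τ in t₀..t, (H τ q - H t₀ p) := by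
    rw [intervalIntegral.integral_sub (hint _ _) intervalIntegrable_const,
      intervalIntegral.integral_const, smul_eq_mul, primitive, primitive,
      intervalIntegral.integral_interval_sub_left (hint _ _) (hint _ _)]
  have h2 : ‖∫ τ in t₀..t, (H τ q - H t₀ p)‖ ≤ c / 2 * |t - t₀| := by
    refine intervalIntegral.norm_integral_le_of_norm_le_const fun τ hτ => hHc τ ?_
    exact Set.abs_sub_left_of_mem_uIcc (Set.uIoc_subset_uIcc hτ)
  have h3 : |inner ℝ (q - p) (x - x₀)| ≤ c / 2 * ‖x - x₀‖ :=
    (abs_real_inner_le_norm _ _).trans (by gcongr)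
  have h4 : score σ (primitive H t) x q - score σ (primitive H t₀) x₀ q -
      (inner ℝ p (x - x₀) - (t - t₀) * H t₀ p) =
      inner ℝ (q - p) (x - x₀) - ∫ τ in t₀..t, (H τ q - H t₀ p) := by
    rw [← h1]
    simp only [score_def, inner_sub_left, inner_sub_right]
    rw [real_inner_comm x q, real_inner_comm x₀ q]
    ring
  have hc0 : 0 ≤ c / 2 := (norm_nonneg _).trans hc
  have h5 : |t - t₀| ≤ ‖(t, x) - (t₀, x₀)‖ := norm_fst_le ((t, x) - (t₀, x₀))
  have h6 : ‖x - x₀‖ ≤ ‖(t, x) - (t₀, x₀)‖ := norm_snd_le ((t, x) - (t₀, x₀))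
  rw [h4]
  calc _ ≤ |inner ℝ (q - p) (x - x₀)| + |∫ τ in t₀..t, (H τ q - H t₀ p)| := abs_sub _ _
    _ ≤ c / 2 * ‖x - x₀‖ + c / 2 * |t - t₀| := add_le_add h3 h2
    _ ≤ c / 2 * ‖(t, x) - (t₀, x₀)‖ + c / 2 * ‖(t, x) - (t₀, x₀)‖ := by gcongr
    _ = _ := by ring

/-- The Hopf formula is differentiable where the maximizer is unique. -/
theorem differentiableAt_hopf_of_unique (hH : Continuous (Function.uncurry H))
    {t₀ N : ℝ} {x₀ p : EuclideanSpace ℝ (Fin n)} (hp : p ∈ conjDom σ)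
    (huniq : ∀ q ∈ conjDom σ, q ≠ p →
      score σ (primitive H t₀) x₀ q < score σ (primitive H t₀) x₀ p)
    (hex : ∀ᶠ z : ℝ × EuclideanSpace ℝ (Fin n) in 𝓝 (t₀, x₀),
      ∃ q, ‖q‖ ≤ N ∧ IsMaximizer H σ z.1 z.2 q) :
    DifferentiableAt ℝ (fun z : ℝ × EuclideanSpace ℝ (Fin n) => hopf H σ z.1 z.2) (t₀, x₀) := by
  have hpm : IsMaximizer H σ t₀ x₀ p := ⟨hp, fun q hq => by
    by_cases h : q = p
    · rw [h]
    · exact (huniq q hq h).le⟩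
  let L : ℝ × EuclideanSpace ℝ (Fin n) →L[ℝ] ℝ :=
    (innerSL ℝ p).comp (ContinuousLinearMap.snd ℝ ℝ _) -
      (H t₀ p) • ContinuousLinearMap.fst ℝ ℝ _
  have hL : ∀ t x, L ((t, x) - (t₀, x₀)) = inner ℝ p (x - x₀) - (t - t₀) * H t₀ p := by
    intro t x
    simp [L, mul_comm]
  refine HasFDerivAt.differentiableAt (f' := L) ?_
  rw [hasFDerivAt_iff_isLittleO, Asymptotics.isLittleO_iff]
  intro c hc
  obtain ⟨η, hη, hHη⟩ := Metric.continuousAt_iff.1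
    (hH.continuousAt (x := (t₀, p))) (c / 2) (by positivity)
  have hη' : 0 < min η (c / 2) := lt_min hη (by positivity)
  have hball : ∀ᶠ z : ℝ × EuclideanSpace ℝ (Fin n) in 𝓝 (t₀, x₀), |z.1 - t₀| < η :=
    (continuous_fst.tendsto (t₀, x₀)).eventually (ball_mem_nhds t₀ hη)
  filter_upwards [hball, hex, eventually_isMaximizer_near (N := N) hH hη' hp huniq]
    with ⟨t, x⟩ ht ⟨q, hqN, hq⟩ hnear
  have hqp := hnear q hqN hq
  have key : ∀ q, ‖q - p‖ < min η (c / 2) → _ := fun q hqp =>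
    abs_score_sub_score_sub_le (σ := σ) (x := x) (x₀ := x₀) (t := t) (t₀ := t₀) (c := c) hH
    (hqp.le.trans (min_le_right _ _)) fun τ hτ => by
      have : dist (τ, q) (t₀, p) < η := by
        rw [Prod.dist_eq]
        refine max_lt (hτ.trans_lt ht) ?_
        simpa [dist_eq_norm] using hqp.trans_le (min_le_left _ _)
      exact (hHη this).le
  -- Since `p` and `q` are maximal at `(t₀, x₀)` and `(t, x)` respectively, the increment of `u`
  -- lies between the score increments of `p` and of `q`.
  have k1 := abs_le.1 (key q hqp)
  have k2 := abs_le.1 (key p (by simpa using hη'))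
  have m1 := hpm.2 q hq.1
  have m2 := hq.2 p hp
  simp only [hL]
  rw [hq.hopf_eq, hpm.hopf_eq, Real.norm_eq_abs, abs_le]
  simp only at m2
  constructor <;> linarith [k1.1, k1.2, k2.1, k2.2]

end Maximizers

/-! ### The time primitive of the Hamiltonian and the structural condition. -/

section Primitive

theorem hasFDerivAt_integral_of_continuous {E : Type*} [NormedAddCommGroup E] [NormedSpace ℝ E]
    [ProperSpace E] {H : ℝ → E → ℝ} {H' : ℝ → E → E →L[ℝ] ℝ}
    (hH : Continuous (Function.uncurry H)) (hH' : Continuous (Function.uncurry H'))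
    (hd : ∀ τ q, HasFDerivAt (H τ) (H' τ q) q) (a b : ℝ) (q : E) :
    HasFDerivAt (fun q => ∫ τ in a..b, H τ q) (∫ τ in a..b, H' τ q) q := by
  have hK : IsCompact (Set.uIcc a b ×ˢ closedBall q 1) :=
    isCompact_uIcc.prod (isCompact_closedBall q 1)
  obtain ⟨C, hC⟩ := hK.exists_bound_of_continuousOn hH'.continuousOn
  have hHq : ∀ q, Continuous fun τ => H τ q := fun q =>
    hH.comp (by fun_prop : Continuous fun τ : ℝ => (τ, q))
  have hHq' : Continuous fun τ => H' τ q :=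
    hH'.comp (by fun_prop : Continuous fun τ : ℝ => (τ, q))
  refine intervalIntegral.hasFDerivAt_integral_of_dominated_of_fderiv_le
    (F := fun q τ => H τ q) (F' := fun q τ => H' τ q)
    (bound := fun _ => C) (closedBall_mem_nhds q one_pos)
    (Eventually.of_forall fun q => (hHq q).aestronglyMeasurable) ((hHq q).intervalIntegrable a b)
    hHq'.aestronglyMeasurable (Eventually.of_forall fun τ hτ y hy => ?_)
    intervalIntegrable_const (Eventually.of_forall fun τ _ y _ => hd τ y)
  exact hC (τ, y) ⟨Set.uIoc_subset_uIcc hτ, hy⟩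

theorem convexOn_integral {E : Type*} [NormedAddCommGroup E] [NormedSpace ℝ E] {H : ℝ → E → ℝ}
    (hH : ∀ q, Continuous fun τ => H τ q) {a b : ℝ} (hab : a ≤ b)
    (hc : ∀ τ ∈ Set.Ioo a b, ConvexOn ℝ Set.univ (H τ)) :
    ConvexOn ℝ Set.univ fun q => ∫ τ in a..b, H τ q := by
  refine ⟨convex_univ, fun p _ q _ r s hr hs hrs => ?_⟩
  have hi : ∀ q, IntervalIntegrable (fun τ => H τ q) MeasureTheory.volume a b := fun q =>
    (hH q).intervalIntegrable a b
  simp only [smul_eq_mul]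
  rw [← intervalIntegral.integral_const_mul, ← intervalIntegral.integral_const_mul,
    ← intervalIntegral.integral_add ((hi p).const_mul r) ((hi q).const_mul s)]
  exact intervalIntegral.integral_mono_on_of_le_Ioo hab (hi _)
    (((hi p).const_mul r).add ((hi q).const_mul s))
    fun τ hτ => (hc τ hτ).2 (Set.mem_univ p) (Set.mem_univ q) hr hs hrs

variable {n : ℕ} {H : ℝ → EuclideanSpace ℝ (Fin n) → ℝ}

theorem primitive_sub_primitive (hH : ∀ q, Continuous fun τ => H τ q) (a b : ℝ)
    (q : EuclideanSpace ℝ (Fin n)) :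
    primitive H b q - primitive H a q = ∫ τ in a..b, H τ q :=
  intervalIntegral.integral_interval_sub_left ((hH q).intervalIntegrable _ _)
    ((hH q).intervalIntegrable _ _)

theorem exists_mul_of_same_sign {A B : ℝ} (h : (0 ≤ A ∧ 0 ≤ B) ∨ (A ≤ 0 ∧ B ≤ 0)) :
    ∃ c : ℝ, 0 ≤ c ∧ c ≤ 1 ∧ A = c * (A + B) := by
  by_cases h0 : A + B = 0
  · refine ⟨0, le_rfl, zero_le_one, ?_⟩
    rcases h with h | h <;> linarith [h.1, h.2]
  · refine ⟨A / (A + B), ?_, ?_, by field_simp⟩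
    · rcases h with ⟨h1, h2⟩ | ⟨h1, h2⟩
      · positivity
      · exact div_nonneg_of_nonpos h1 (by linarith)
    · rcases h with ⟨h1, h2⟩ | ⟨h1, h2⟩
      · exact div_le_one_of_le₀ (by linarith) (by linarith)
      · exact div_le_one_of_ge (by linarith) (by linarith)

/-- No regularity of `g` and `k` is given, so only differences `H τ a - H τ b` are integrated: `k`
drops out and `g` survives up to a factor. Its constant sign makes the integrals over `[0, t₀]` and
`[t₀, t₁]` agree in sign, and `c` is the share of the former in their sum. -/
theorem exists_proportional_of_separated (hH : ∀ q, Continuous fun τ => H τ q) {T t₀ t₁ : ℝ}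
    (h0 : 0 ≤ t₀) (h01 : t₀ ≤ t₁) (h1 : t₁ ≤ T) {g k : ℝ → ℝ} {h : EuclideanSpace ℝ (Fin n) → ℝ}
    (hgh : ∀ t ∈ Set.Ioo 0 T, ∀ p, H t p = g t * h p + k t)
    (hg : (∀ t ∈ Set.Ioo 0 T, 0 ≤ g t) ∨ (∀ t ∈ Set.Ioo 0 T, g t ≤ 0)) :
    ∃ c : ℝ, 0 ≤ c ∧ c ≤ 1 ∧ ∀ p q, primitive H t₀ q - primitive H t₀ p =
      c * (primitive H t₁ q - primitive H t₁ p) := by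
  have hi : ∀ q a b, IntervalIntegrable (fun τ => H τ q) MeasureTheory.volume a b := fun q a b =>
    (hH q).intervalIntegrable a b
  have hdiff : ∀ {a b : ℝ} p q, ∫ τ in a..b, (H τ q - H τ p) =
      (∫ τ in a..b, H τ q) - ∫ τ in a..b, H τ p := fun p q =>
    intervalIntegral.integral_sub (hi q _ _) (hi p _ _)
  by_cases hconst : ∀ p q, h q ≤ h p
  · refine ⟨0, le_rfl, zero_le_one, fun p q => ?_⟩
    rw [zero_mul, primitive, primitive, ← hdiff]
    refine (intervalIntegral.integral_congr_Ioo_of_le h0 (g := fun _ => (0 : ℝ))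
      fun τ hτ => ?_).trans intervalIntegral.integral_zero
    have hτ' : τ ∈ Set.Ioo 0 T := ⟨hτ.1, hτ.2.trans_le (h01.trans h1)⟩
    simp only [hgh τ hτ', le_antisymm (hconst p q) (hconst q p), sub_self]
  · push Not at hconst
    obtain ⟨b, a, hab⟩ := hconst
    have hscale : ∀ t ∈ Set.Icc 0 T, ∀ p q, primitive H t q - primitive H t p =
        (h q - h p) / (h a - h b) * (primitive H t a - primitive H t b) := by
      intro t ht p q
      simp only [primitive]
      rw [← hdiff, ← hdiff, ← intervalIntegral.integral_const_mul]
      refine intervalIntegral.integral_congr_Ioo_of_le ht.1 fun τ hτ => ?_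
      have hτ' : τ ∈ Set.Ioo 0 T := ⟨hτ.1, hτ.2.trans_le ht.2⟩
      have hne : h a - h b ≠ 0 := (sub_pos.2 hab).ne'
      simp only [hgh τ hτ']
      field_simp
      ring
    have hsign : ∀ s t, 0 ≤ s → s ≤ t → t ≤ T →
        ((∀ t ∈ Set.Ioo 0 T, 0 ≤ g t) → 0 ≤ ∫ τ in s..t, (H τ a - H τ b)) ∧
        ((∀ t ∈ Set.Ioo 0 T, g t ≤ 0) → ∫ τ in s..t, (H τ a - H τ b) ≤ 0) := by
      intro s t hs hst htT
      have hz : ∫ _τ in s..t, (0 : ℝ) = 0 := intervalIntegral.integral_zero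
      constructor <;> intro hg
      · rw [← hz]
        refine intervalIntegral.integral_mono_on_of_le_Ioo hst intervalIntegrable_const
          ((hi a _ _).sub (hi b _ _)) fun τ hτ => ?_
        have hτ' : τ ∈ Set.Ioo 0 T := ⟨hs.trans_lt hτ.1, hτ.2.trans_le htT⟩
        rw [hgh τ hτ', hgh τ hτ']
        nlinarith [hg τ hτ', sub_pos.2 hab]
      · rw [← hz]
        refine intervalIntegral.integral_mono_on_of_le_Ioo hst
          ((hi a _ _).sub (hi b _ _)) intervalIntegrable_const fun τ hτ => ?_
        have hτ' : τ ∈ Set.Ioo 0 T := ⟨hs.trans_lt hτ.1, hτ.2.trans_le htT⟩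
        rw [hgh τ hτ', hgh τ hτ']
        nlinarith [hg τ hτ', sub_pos.2 hab]
    have s1 := hsign 0 t₀ le_rfl h0 (h01.trans h1)
    have s2 := hsign t₀ t₁ h0 h01 h1
    obtain ⟨c, hc0, hc1, hc⟩ := exists_mul_of_same_sign
      (hg.imp (fun hg => ⟨s1.1 hg, s2.1 hg⟩) fun hg => ⟨s1.2 hg, s2.2 hg⟩)
    refine ⟨c, hc0, hc1, fun p q => ?_⟩
    have hc' : primitive H t₀ a - primitive H t₀ b =
        c * (primitive H t₁ a - primitive H t₁ b) := by
      rw [hdiff, hdiff, ← primitive_sub_primitive hH t₀ t₁ a,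
        ← primitive_sub_primitive hH t₀ t₁ b] at hc
      simp only [primitive] at hc ⊢
      linear_combination hc
    rw [hscale t₀ ⟨h0, h01.trans h1⟩, hscale t₁ ⟨h0.trans h01, h1⟩, hc']
    ring

theorem primitive_trichotomy (hH : ∀ q, Continuous fun τ => H τ q) {T t₀ t₁ : ℝ}
    (h0 : 0 ≤ t₀) (h01 : t₀ ≤ t₁) (h1 : t₁ ≤ T) (hA2 : Structural T H) :
    ConvexOn ℝ Set.univ (primitive H t₀) ∨
    ConcaveOn ℝ Set.univ (fun q => primitive H t₁ q - primitive H t₀ q) ∨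
    ∃ c : ℝ, 0 ≤ c ∧ c ≤ 1 ∧ ∀ p q, primitive H t₀ q - primitive H t₀ p =
      c * (primitive H t₁ q - primitive H t₁ p) := by
  rcases hA2 with (hc | hc) | ⟨g, h, k, hgh, hg⟩
  · exact Or.inl (convexOn_integral hH h0 fun τ hτ =>
      hc τ ⟨hτ.1, hτ.2.trans_le (h01.trans h1)⟩)
  · refine Or.inr (Or.inl ?_)
    simp only [primitive_sub_primitive hH]
    have := convexOn_integral (H := fun τ q => -H τ q) (fun q => (hH q).neg) h01
      fun τ hτ => (hc τ ⟨h0.trans_lt hτ.1, hτ.2.trans_le h1⟩).neg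
    simp only [intervalIntegral.integral_neg] at this
    exact neg_convexOn_iff.1 this
  · exact Or.inr (Or.inr (exists_proportional_of_separated hH h0 h01 h1 hgh hg))

end Primitive

/-! ### Forward propagation of singularities. -/

section Propagation

variable {n : ℕ} {H : ℝ → EuclideanSpace ℝ (Fin n) → ℝ} {σ : EuclideanSpace ℝ (Fin n) → ℝ}

/-- If the Hopf formula is differentiable at every point of a small ball at time `t₁`, then the
maximizer is unique at the centre of the ball at the earlier time `t₀`. -/
theorem exists_unique_maximizer_of_differentiableAt (hσ : Differentiable ℝ σ)
    (hσc : ConvexOn ℝ Set.univ σ) {T t₀ t₁ N ε : ℝ} (hH : ∀ q, Continuous fun τ => H τ q)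
    (h0 : 0 ≤ t₀) (h01 : t₀ ≤ t₁) (h1 : t₁ ≤ T) (hA2 : Structural T H)
    {G : ℝ → EuclideanSpace ℝ (Fin n) → EuclideanSpace ℝ (Fin n)}
    (hG : ∀ t q, HasGradientAt (primitive H t) (G t q) q)
    {x₀ : EuclideanSpace ℝ (Fin n)} (hN : 0 ≤ N) (hε : 0 < ε)
    (hG' : ∀ q, ‖q‖ ≤ N → ‖G t₁ q - G t₀ q‖ < ε)
    (hex₀ : ∃ p, IsMaximizer H σ t₀ x₀ p)
    (hex : ∀ x ∈ closedBall x₀ ε, ∃ p, ‖p‖ ≤ N ∧ IsMaximizer H σ t₁ x p)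
    (hdiff : ∀ x ∈ closedBall x₀ ε, DifferentiableAt ℝ (hopf H σ t₁) x) :
    ∃ p ∈ conjDom σ, ∀ q ∈ conjDom σ, q ≠ p →
      score σ (primitive H t₀) x₀ q < score σ (primitive H t₀) x₀ p := by
  -- When the primitive at `t₀` is convex, uniqueness holds without any information at time `t₁`.
  rcases primitive_trichotomy hH h0 h01 h1 hA2 with hc | hstruct
  · obtain ⟨p, hpD, hp⟩ := hex₀
    refine ⟨p, hpD, fun q hq hne => lt_of_le_of_ne (hp q hq) fun heq => hne ?_⟩
    exact eq_of_isMax_of_convexOn hσ hσc (fun q => (hG t₀ q).differentiableAt) hc hpD hq hp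
      fun r hr => heq ▸ hp r hr
  have hsub : ∀ x ∈ closedBall x₀ ε, ∀ p, IsMaximizer H σ t₁ x p → ∀ y ∈ closedBall x₀ ε,
      hopf H σ t₁ x + inner ℝ p (y - x) ≤ hopf H σ t₁ y := by
    intro x _ p hp y hy
    obtain ⟨q, -, hq⟩ := hex y hy
    rw [hp.hopf_eq, hq.hopf_eq]
    have := hq.2 p hp.1
    simp only [score_def] at this ⊢
    rw [inner_sub_right, real_inner_comm x p, real_inner_comm y p]
    linarith
  obtain ⟨p, hpN, hp⟩ := exists_eq_add_gradient_of_subgradient hN hε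
    (v := hopf H σ t₁) (F := fun q => primitive H t₁ q - primitive H t₀ q)
    (F' := fun q => G t₁ q - G t₀ q) (x₀ := x₀)
    (fun x hx => (hdiff x hx).continuousAt.continuousWithinAt)
    (fun q => by
      rw [hasGradientAt_iff_hasFDerivAt, map_sub]
      exact (hG t₁ q).hasFDerivAt.sub (hG t₀ q).hasFDerivAt) hG'
    (fun x hx => by
      obtain ⟨p, hpN, hp⟩ := hex x hx
      exact ⟨p, hpN, hsub x hx p hp⟩)
  set x := x₀ + (G t₁ p - G t₀ p) with hx
  have hxb : x ∈ ball x₀ ε := by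
    rw [mem_ball, dist_eq_norm, hx, add_sub_cancel_left]
    exact hG' p hpN
  have hxB := ball_subset_closedBall hxb
  have hnhds : closedBall x₀ ε ∈ 𝓝 x := mem_of_superset (isOpen_ball.mem_nhds hxb)
    ball_subset_closedBall
  have huniq : ∀ m, (∀ y ∈ closedBall x₀ ε,
      hopf H σ t₁ x + inner ℝ m (y - x) ≤ hopf H σ t₁ y) → m = gradient (hopf H σ t₁) x :=
    fun m hm => eq_of_forall_le_add_inner (hdiff x hxB).hasGradientAt
      (mem_of_superset hnhds hm)
  obtain ⟨m, -, hm⟩ := hex x hxB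
  have hpm : m = p := (huniq m (hsub x hxB m hm)).trans (huniq p hp).symm
  rw [hpm] at hm
  have hmax : ∀ q ∈ conjDom σ, q ≠ p →
      score σ (primitive H t₁) x q < score σ (primitive H t₁) x p := by
    intro q hq hne
    -- A second maximizer at `x` would be a second subgradient at a point of differentiability.
    refine lt_of_le_of_ne (hm.2 q hq) fun heq => hne ?_
    have hqm : IsMaximizer H σ t₁ x q := ⟨hq, fun r hr => heq ▸ hm.2 r hr⟩
    exact (huniq q (hsub x hxB q hqm)).trans (huniq p hp).symm
  refine ⟨p, hm.1, fun q hq hne => ?_⟩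
  rcases hstruct with hc | ⟨c, hc0, hc1, hc⟩
  · exact score_lt_of_concaveOn (hG t₀ p) (hG t₁ p) hc (hmax q hq hne)
  · exact score_lt_of_proportional hσ hσc (hG t₀ p) (hG t₁ p) hc0 hc1 (hc p) hm.1 hmax hq hne

/-- Forward propagation of singularities for a globally defined Hamiltonian. -/
theorem propagation_of_continuous {T : ℝ}
    {H' : ℝ → EuclideanSpace ℝ (Fin n) → EuclideanSpace ℝ (Fin n) →L[ℝ] ℝ}
    (hH : Continuous (Function.uncurry H)) (hH' : Continuous (Function.uncurry H'))
    (hd : ∀ τ q, HasFDerivAt (H τ) (H' τ q) q)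
    (hσ : Differentiable ℝ σ) (hσc : ConvexOn ℝ Set.univ σ)
    (hA1 : Compatible T H σ) (hA2 : Structural T H) {t₀ : ℝ} {x₀ : EuclideanSpace ℝ (Fin n)}
    (hsing : IsSingular T (hopf H σ) t₀ x₀) {ε : ℝ} (hε : 0 < ε) :
    ∃ δ > 0, ∀ t' : ℝ, t₀ < t' → |t' - t₀| ≤ δ →
      ∃ x' ∈ closedBall x₀ ε, IsSingular T (hopf H σ) t' x' := by
  obtain ⟨⟨ht0, htT⟩, hnd⟩ := hsing
  obtain ⟨r, hr, N, hN, hA⟩ := hA1 t₀ ⟨ht0.le, htT⟩ x₀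
  have hHq : ∀ q, Continuous fun τ => H τ q := fun q =>
    hH.comp (by fun_prop : Continuous fun τ : ℝ => (τ, q))
  have hne : (conjDom σ).Nonempty :=
    ⟨_, mem_conjDom_of_hasGradientAt hσc (hσ 0).hasGradientAt⟩
  have hex : ∀ t ∈ Set.Ico 0 T, ∀ x, |t - t₀| + ‖x - x₀‖ < r →
      ∃ p, ‖p‖ ≤ N ∧ IsMaximizer H σ t x p := by
    intro t ht x htx
    obtain ⟨p, hp⟩ := exists_isMaximizer hH hne hN.le fun p hp => hA t ht x p htx hp
    exact ⟨p, hp.norm_le fun p hp => hA t ht x p htx hp, hp⟩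
  obtain ⟨C, hC⟩ := (isCompact_Icc.prod (isCompact_closedBall
    (0 : EuclideanSpace ℝ (Fin n)) N)).exists_bound_of_continuousOn
    (s := Set.Icc t₀ T ×ˢ closedBall 0 N) hH'.continuousOn
  have hC0 : 0 ≤ C := (norm_nonneg _).trans
    (hC (t₀, 0) ⟨⟨le_rfl, htT.le⟩, mem_closedBall_self hN.le⟩)
  set e := min ε (r / 3) with he
  have he0 : 0 < e := lt_min hε (by positivity)
  -- The three bounds keep `(t', x)` within the range `r` of the compatibility condition for `x` in
  -- the `e`-ball, keep `t' < T`, and keep the displacement `‖G t' q - G t₀ q‖ ≤ C |t' - t₀|` below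
  -- `e`.
  refine ⟨min (r / 3) (min ((T - t₀) / 2) (e / (2 * (C + 1)))),
    lt_min (by positivity) (lt_min (by linarith) (by positivity)), fun t' htt' hδ => ?_⟩
  have hδ1 : |t' - t₀| ≤ r / 3 := hδ.trans (min_le_left _ _)
  have hδ2 : |t' - t₀| ≤ (T - t₀) / 2 := hδ.trans ((min_le_right _ _).trans (min_le_left _ _))
  have hδ3 : |t' - t₀| ≤ e / (2 * (C + 1)) :=
    hδ.trans ((min_le_right _ _).trans (min_le_right _ _))
  have ht'T : t' < T := by
    have := le_abs_self (t' - t₀)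
    linarith
  have ht'0 : 0 < t' := ht0.trans htt'
  by_contra! hreg
  set G : ℝ → EuclideanSpace ℝ (Fin n) → EuclideanSpace ℝ (Fin n) := fun t q =>
    (InnerProductSpace.toDual ℝ _).symm (∫ τ in (0 : ℝ)..t, H' τ q) with hGdef
  have hG : ∀ t q, HasGradientAt (primitive H t) (G t q) q := fun t q =>
    (hasFDerivAt_integral_of_continuous hH hH' hd 0 t q).hasGradientAt
  have hG' : ∀ q, ‖q‖ ≤ N → ‖G t' q - G t₀ q‖ < e := by
    intro q hq
    have hHq' : Continuous fun τ => H' τ q :=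
      hH'.comp (by fun_prop : Continuous fun τ : ℝ => (τ, q))
    rw [hGdef]
    simp only
    rw [← map_sub, LinearIsometryEquiv.norm_map, intervalIntegral.integral_interval_sub_left
      (hHq'.intervalIntegrable _ _) (hHq'.intervalIntegrable _ _)]
    have h1 : ‖∫ τ in t₀..t', H' τ q‖ ≤ C * |t' - t₀| := by
      refine intervalIntegral.norm_integral_le_of_norm_le_const fun τ hτ => ?_
      rw [Set.uIoc_of_le htt'.le] at hτ
      exact hC (τ, q) ⟨⟨hτ.1.le, hτ.2.trans ht'T.le⟩, by simpa using hq⟩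
    have h2 : (C + 1) * |t' - t₀| ≤ e / 2 := by
      calc (C + 1) * |t' - t₀| ≤ (C + 1) * (e / (2 * (C + 1))) := by gcongr
        _ = e / 2 := by field_simp
    nlinarith [abs_nonneg (t' - t₀)]
  have hdiff : ∀ x ∈ closedBall x₀ e, DifferentiableAt ℝ (hopf H σ t') x := by
    intro x hx
    have h := hreg x (closedBall_subset_closedBall (min_le_left _ _) hx)
    rw [IsSingular, not_and, not_not] at h
    exact (h ⟨ht'0, ht'T⟩).comp x ((differentiableAt_const t').prodMk differentiableAt_id)
  obtain ⟨p, hp, huniq⟩ := exists_unique_maximizer_of_differentiableAt hσ hσc hHq ht0.le htt'.le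
    ht'T.le hA2 hG hN.le he0 hG'
    ((hex t₀ ⟨ht0.le, htT⟩ x₀ (by simpa using hr)).imp fun p hp => hp.2)
    (fun x hx => hex t' ⟨ht'0.le, ht'T⟩ x (by
      rw [mem_closedBall, dist_eq_norm] at hx
      linarith [min_le_right ε (r / 3)])) hdiff
  refine hnd (differentiableAt_hopf_of_unique (N := N) hH hp huniq ?_)
  have e1 : ∀ᶠ z : ℝ × EuclideanSpace ℝ (Fin n) in 𝓝 (t₀, x₀), z.1 ∈ Set.Ioo 0 T :=
    (continuous_fst.tendsto (t₀, x₀)).eventually (Ioo_mem_nhds ht0 htT)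
  have e2 : ∀ᶠ z : ℝ × EuclideanSpace ℝ (Fin n) in 𝓝 (t₀, x₀),
      |z.1 - t₀| + ‖z.2 - x₀‖ < r := by
    have hcont : Continuous fun z : ℝ × EuclideanSpace ℝ (Fin n) =>
      |z.1 - t₀| + ‖z.2 - x₀‖ := by fun_prop
    exact (hcont.tendsto (t₀, x₀)).eventually (Iio_mem_nhds (by simpa using hr))
  filter_upwards [e1, e2] with z h1 h2
  exact hex z.1 ⟨h1.1.le, h1.2⟩ z.2 h2

end Propagation

/-! ### Reduction to a Hamiltonian defined for all times. -/

section Extension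

variable {n : ℕ} {T : ℝ}

/-- The Hamiltonian frozen in time outside `[0, T]`. -/
noncomputable def timeExtend (hT : 0 ≤ T) (H : ℝ → EuclideanSpace ℝ (Fin n) → ℝ) (τ : ℝ)
    (q : EuclideanSpace ℝ (Fin n)) : ℝ := H (Set.projIcc 0 T hT τ) q

theorem timeExtend_of_mem (hT : 0 ≤ T) (H : ℝ → EuclideanSpace ℝ (Fin n) → ℝ) {τ : ℝ}
    (hτ : τ ∈ Set.Icc 0 T) : timeExtend hT H τ = H τ := by
  funext q
  rw [timeExtend, Set.projIcc_of_mem hT hτ]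

theorem phi_timeExtend (hT : 0 ≤ T) (H : ℝ → EuclideanSpace ℝ (Fin n) → ℝ)
    (σ : EuclideanSpace ℝ (Fin n) → ℝ) {t : ℝ} (ht : t ∈ Set.Icc 0 T) :
    phi (timeExtend hT H) σ t = phi H σ t := by
  funext x q
  rw [phi, phi, intervalIntegral.integral_congr (g := fun τ => H τ q)]
  intro τ hτ
  rw [Set.uIcc_of_le ht.1] at hτ
  simp only [timeExtend_of_mem hT H ⟨hτ.1, hτ.2.trans ht.2⟩]

theorem compatible_timeExtend (hT : 0 ≤ T) {H : ℝ → EuclideanSpace ℝ (Fin n) → ℝ}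
    {σ : EuclideanSpace ℝ (Fin n) → ℝ} (h : Compatible T H σ) :
    Compatible T (timeExtend hT H) σ := by
  intro t₀ ht₀ x₀
  obtain ⟨r, hr, N, hN, hA⟩ := h t₀ ht₀ x₀
  refine ⟨r, hr, N, hN, fun t ht x p => ?_⟩
  rw [phi_timeExtend hT H σ (Set.Ico_subset_Icc_self ht)]
  exact hA t ht x p

theorem structural_timeExtend (hT : 0 ≤ T) {H : ℝ → EuclideanSpace ℝ (Fin n) → ℝ}
    (h : Structural T H) : Structural T (timeExtend hT H) := by
  have he : ∀ t ∈ Set.Ioo 0 T, timeExtend hT H t = H t := fun t ht =>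
    timeExtend_of_mem hT H (Set.Ioo_subset_Icc_self ht)
  rcases h with (h | h) | ⟨g, f, k, h, hg⟩
  · exact Or.inl (Or.inl fun t ht => (he t ht).symm ▸ h t ht)
  · exact Or.inl (Or.inr fun t ht => (he t ht).symm ▸ h t ht)
  · exact Or.inr ⟨g, f, k, fun t ht => (he t ht).symm ▸ h t ht, hg⟩

theorem isSingular_timeExtend_iff (hT : 0 ≤ T) {H : ℝ → EuclideanSpace ℝ (Fin n) → ℝ}
    {σ : EuclideanSpace ℝ (Fin n) → ℝ} {t : ℝ} {x : EuclideanSpace ℝ (Fin n)} :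
    IsSingular T (hopf (timeExtend hT H) σ) t x ↔ IsSingular T (hopf H σ) t x := by
  refine and_congr_right fun ht => not_congr (Filter.EventuallyEq.differentiableAt_iff ?_)
  have e1 : ∀ᶠ z : ℝ × EuclideanSpace ℝ (Fin n) in 𝓝 (t, x), z.1 ∈ Set.Ioo 0 T :=
    (continuous_fst.tendsto (t, x)).eventually (Ioo_mem_nhds ht.1 ht.2)
  filter_upwards [e1] with z hz
  rw [hopf, hopf, phi_timeExtend hT H σ (Set.Ioo_subset_Icc_self hz)]

/-- Freezing in time destroys differentiability in `τ`, but the propagation argument uses only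
continuity and a continuous derivative in `q`. -/
theorem exists_fderiv_timeExtend (hT : 0 < T) {H : ℝ → EuclideanSpace ℝ (Fin n) → ℝ}
    (hH : ContDiffOn ℝ 1 (fun z : ℝ × EuclideanSpace ℝ (Fin n) => H z.1 z.2)
      (Set.Icc 0 T ×ˢ Set.univ)) :
    Continuous (Function.uncurry (timeExtend hT.le H)) ∧
    ∃ H' : ℝ → EuclideanSpace ℝ (Fin n) → EuclideanSpace ℝ (Fin n) →L[ℝ] ℝ,
      Continuous (Function.uncurry H') ∧
      ∀ τ q, HasFDerivAt (timeExtend hT.le H τ) (H' τ q) q := by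
  set S : Set (ℝ × EuclideanSpace ℝ (Fin n)) := Set.Icc 0 T ×ˢ Set.univ with hS
  set f : ℝ × EuclideanSpace ℝ (Fin n) → ℝ := fun z => H z.1 z.2
  have hU : UniqueDiffOn ℝ S := (uniqueDiffOn_Icc hT).prod uniqueDiffOn_univ
  have hproj : Continuous fun z : ℝ × EuclideanSpace ℝ (Fin n) =>
      ((Set.projIcc 0 T hT.le z.1 : ℝ), z.2) := by
    have := continuous_projIcc (h := hT.le)
    fun_prop
  have hmem : ∀ z : ℝ × EuclideanSpace ℝ (Fin n),
      ((Set.projIcc 0 T hT.le z.1 : ℝ), z.2) ∈ S := fun z => ⟨Subtype.coe_prop _, trivial⟩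
  refine ⟨hH.continuousOn.comp_continuous hproj hmem, fun τ q =>
    (fderivWithin ℝ f S ((Set.projIcc 0 T hT.le τ : ℝ), q)).comp
      (ContinuousLinearMap.inr ℝ ℝ _), ?_, fun τ q => ?_⟩
  · have h1 := (hH.continuousOn_fderivWithin hU le_rfl).comp_continuous hproj hmem
    exact h1.clm_comp continuous_const
  · have h1 := ((hH.differentiableOn one_ne_zero) _ (hmem (τ, q))).hasFDerivWithinAt
    have h2 : HasFDerivAt (fun q : EuclideanSpace ℝ (Fin n) =>
        ((Set.projIcc 0 T hT.le τ : ℝ), q)) (ContinuousLinearMap.inr ℝ ℝ _) q :=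
      hasFDerivAt_prodMk_right _ _
    exact h1.comp_hasFDerivAt q h2 (Eventually.of_forall fun q => hmem (τ, q))

end Extension

end HopfFormula

theorem theorem3p4 {n : ℕ} (T : ℝ) (hT : 0 < T)
    (H : ℝ → EuclideanSpace ℝ (Fin n) → ℝ) (σ : EuclideanSpace ℝ (Fin n) → ℝ)
    (hH : ContDiffOn ℝ 1 (fun z : ℝ × EuclideanSpace ℝ (Fin n) => H z.1 z.2)
      (Set.Icc 0 T ×ˢ Set.univ))
    (hσ : ContDiff ℝ 1 σ) (hσc : ConvexOn ℝ Set.univ σ)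
    (hA1 : HopfFormula.Compatible T H σ) (hA2 : HopfFormula.Structural T H)
    (t₀ : ℝ) (x₀ : EuclideanSpace ℝ (Fin n))
    (hsing : HopfFormula.IsSingular T (HopfFormula.hopf H σ) t₀ x₀) :
    ∀ ε > 0, ∃ δ > 0, ∀ t' : ℝ, t₀ < t' → |t' - t₀| ≤ δ →
      ∃ x' ∈ Metric.closedBall x₀ ε,
        HopfFormula.IsSingular T (HopfFormula.hopf H σ) t' x' := by
  intro ε hε
  obtain ⟨hc, H', hc', hd⟩ := HopfFormula.exists_fderiv_timeExtend hT hH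
  obtain ⟨δ, hδ, h⟩ := HopfFormula.propagation_of_continuous hc hc' hd
    (hσ.differentiable one_ne_zero) hσc (HopfFormula.compatible_timeExtend hT.le hA1)
    (HopfFormula.structural_timeExtend hT.le hA2)
    ((HopfFormula.isSingular_timeExtend_iff hT.le).2 hsing) hε
  refine ⟨δ, hδ, fun t' h1 h2 => ?_⟩
  obtain ⟨x', hx', hs⟩ := h t' h1 h2
  exact ⟨x', hx', (HopfFormula.isSingular_timeExtend_iff hT.le).1 hs⟩
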